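/- Let $V\subset\mathbb C^n$ be a smooth set that is the difference of two algebraic sets; smooth means that near each of its points $V$ is the zero set of finitely many holomorphic functions whose differentials at that point are linearly independent, i.e. $V$ is a complex submanifold (possibly with components of different dimensions). Let $B_1,\dots,B_n\subset\mathbb Z^m$ be non-empty finite sets, and let $\mathbb C^{B_i}$ be the space of Laurent polynomials $f_i(x)=\sum_{b\in B_i}c_{i,b}x^b$, $c_{i,b}\in\mathbb C$, where $x^b=x_1^{b_1}\cdots x_m^{b_m}$. Then for a generic tuple $(f_1,\dots,f_n)\in\mathbb C^{B_1}\oplus\cdots\oplus\mathbb C^{B_n}$, i.e. for every tuple outside some proper algebraic subset of this space, the map $f=(f_1,\dots,f_n):(\mathbb C\setminus\{0\})^m\to\mathbb C^n$ is transversal to $V$: for every $x\in(\mathbb C\setminus\{0\})^m$ with $f(x)\in V$ (including those for which $f(x)$ lies on coordinate hyperplanes of $\mathbb C^n$) we have $df_x(\mathbb C^m)+T_{f(x)}V=\mathbb C^n$. In particular, the preimage $f^{-1}(V)\subset(\mathbb C\setminus\{0\})^m$ is smooth. -/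

import Mathlib

open Topology

/-- A (Zariski closed) algebraic subset of the affine space `σ → ℂ`. -/
def IsAlgebraicSet {σ : Type*} (Z : Set (σ → ℂ)) : Prop :=
  ∃ I : Ideal (MvPolynomial σ ℂ), Z = MvPolynomial.zeroLocus ℂ I

/-- A set that is the difference of two algebraic sets. -/
def IsDifferenceOfAlgebraicSets {σ : Type*} (V : Set (σ → ℂ)) : Prop :=
  ∃ X Y : Set (σ → ℂ), IsAlgebraicSet X ∧ IsAlgebraicSet Y ∧ V = X \ Y

/-- A property holds for generic `c` if it holds for all `c` outside a proper algebraic subset,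
that is, on a nonempty Zariski open set. -/
def HoldsGenerically {σ : Type*} (Q : (σ → ℂ) → Prop) : Prop :=
  ∃ Z : Set (σ → ℂ), IsAlgebraicSet Z ∧ Z ≠ Set.univ ∧ ∀ c, c ∉ Z → Q c

/-- `g₁ = ⋯ = g_k = 0` is a regular system of (holomorphic) equations of `V` near `p`: the `g_i`
are holomorphic near `p`, their differentials at `p` are linearly independent, and near `p` the set
`V` is their common zero locus. Then `V` is near `p` a complex submanifold of codimension `k`,
with tangent space `ker (dg_p)` at `p`. -/
structure IsRegularSystemAt {n k : ℕ} (g : (Fin n → ℂ) → (Fin k → ℂ)) (V : Set (Fin n → ℂ))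
    (p : Fin n → ℂ) : Prop where
  analyticAt : AnalyticAt ℂ g p
  surjective : Function.Surjective (fderiv ℂ g p)
  mem_iff : ∀ᶠ y in 𝓝 p, y ∈ V ↔ g y = 0

/-- `V` is smooth: a complex submanifold of `ℂⁿ` (not necessarily closed, connected, or of the same
dimension at all its points). -/
def IsSmoothSet {n : ℕ} (V : Set (Fin n → ℂ)) : Prop :=
  ∀ p ∈ V, ∃ (k : ℕ) (g : (Fin n → ℂ) → (Fin k → ℂ)), IsRegularSystemAt g V p

/-- The map `f` is transversal to the smooth set `V` at `x`: if `f x ∈ V`, then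
`df (T_x ℂᵐ) + T_{f x} V = T_{f x} ℂⁿ`. The tangent space of `V` is `ker dg` for a regular system
of equations `g` of `V` near `f x`; it does not depend on the choice of `g`. -/
def IsTransversalAt {m n : ℕ} (f : (Fin m → ℂ) → (Fin n → ℂ)) (V : Set (Fin n → ℂ))
    (x : Fin m → ℂ) : Prop :=
  f x ∈ V → ∃ (k : ℕ) (g : (Fin n → ℂ) → (Fin k → ℂ)), IsRegularSystemAt g V (f x) ∧
    LinearMap.range (fderiv ℂ f x).toLinearMap ⊔
      LinearMap.ker (fderiv ℂ g (f x)).toLinearMap = ⊤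

/-- The complex torus `(ℂ \ {0})ᵐ`, as an open subset of `ℂᵐ`. -/
def complexTorus (m : ℕ) : Set (Fin m → ℂ) := {x | ∀ j, x j ≠ 0}

/-- The map `f = (f₁, …, fₙ)` on the torus given by the Laurent polynomials
`f_i(x) = ∑_{b ∈ B_i} c_{i,b} x^b` with supports `B_i ⊂ ℤᵐ`. A point
`c : (Σ i, B i) → ℂ` is a point of the coefficient space `ℂ^{B₁} ⊕ ⋯ ⊕ ℂ^{Bₙ}`. -/
noncomputable def sparseMap {m n : ℕ} (B : Fin n → Finset (Fin m → ℤ))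
    (c : (Σ i, B i) → ℂ) (x : Fin m → ℂ) : Fin n → ℂ :=
  fun i => ∑ b : B i, c ⟨i, b⟩ * ∏ j, x j ^ (b : Fin m → ℤ) j

/-!
Let `x` run over the torus and `c` over the coefficient space. Each `B i` is non-empty and monomials
do not vanish on the torus, so `(x, c) ↦ f_c(x)` is a submersion in the direction of `c` alone
(`exists_sparseMap_eq`). Hence `f_c` is transversal to `V` at `x` as soon as the incidence set
`{(x, c) | f_c(x) ∈ V}` has a differentiable local section `s ↦ (ξ s, s)` through `(x, c)`:
differentiating `g (f_s (ξ s)) = 0`, where `g` is a regular system of equations of `V`, gives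
`∂_c f δ + df_c (dξ δ) ∈ ker dg`, and `∂_c f δ` is arbitrary (`sup_ker_eq_top_of_section`).

It remains to see that for `c` outside a hypersurface such a section passes through *every* point
of the incidence set over `c`. This holds for any algebraic set over the coefficient space, smooth
or not, and is the property `HasGenericSections`. In particular it is never needed that tangency to
`V` is an algebraic condition. The property is proved by adding the fibre coordinates one at a time
(`HasGenericSections.polynomial`). Given equations `p ∈ R[t]` over a base with coordinate ring `R`,
a point `(u, t)` at which all `p(u, ·)` vanish identically is handled by a section of the locus
where all coefficients vanish, with `t` kept constant. At any other point `t` is a root of some nonzero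
`A(u, ·)`, and one descends on the degree of `A`: replace `A` by `A` without its leading term if the
leading coefficient vanishes at `u`, by `A'` if `t` is a multiple root, by the pseudo-remainder of
some `p` modulo `A` if that is nonzero at `u`. When none of these applies, the equations `p = 0`
follow from `A = 0` over the locus where the remainders vanish, and the simple root `t` of `A`
extends along a section of that locus by the implicit function theorem
(`HasLocalSectionAt.lift_simple_root`). Only finitely many polynomials occur in the descent, so
finitely many hypersurfaces are discarded.

Since `V` is open in its ambient algebraic set `X`, sections of the incidence set of `X` suffice.
Laurent monomials become polynomial after adding coordinates `y j` with `x j * y j = 1`.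
-/

/-! ### Pseudo-division -/

open Polynomial in
/-- Division with remainder by `A`, after multiplication by a power of the leading coefficient
of `A`. -/
theorem Polynomial.exists_pseudo_remainder {R : Type*} [CommRing R] {A : R[X]}
    (hA : 0 < A.natDegree) (p : R[X]) :
    ∃ (k : ℕ) (Q r : R[X]), C A.leadingCoeff ^ k * p = Q * A + r ∧ r.natDegree < A.natDegree := by
  induction hn : p.natDegree using Nat.strong_induction_on generalizing p with
  | _ n ih =>
    rcases lt_or_ge p.natDegree A.natDegree with hlt | hge
    · exact ⟨0, 0, p, by simp, hlt⟩
    · have hlt := natDegree_cancelLeads_lt_of_natDegree_le_natDegree hge (hA.trans_le hge)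
      obtain ⟨k, Q, r, h, hr⟩ := ih _ (hn ▸ hlt) (A.cancelLeads p) rfl
      refine ⟨k + 1, Q + C A.leadingCoeff ^ k *
        (C p.leadingCoeff * X ^ (p.natDegree - A.natDegree)), r, ?_, hr⟩
      have : A.cancelLeads p = C A.leadingCoeff * p
          - C p.leadingCoeff * X ^ (p.natDegree - A.natDegree) * A := by
        simp [cancelLeads, Nat.sub_eq_zero_of_le hge]
      rw [this] at h
      linear_combination h

/-! ### Generic local sections of algebraic families -/

section Sections

variable {σ U R : Type*} [CommRing R]

/-- Evaluation of polynomials over `R`, as functions on `U × ℂ`. -/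
noncomputable def polyEval (ev : U → R →+* ℂ) (v : U × ℂ) : Polynomial R →+* ℂ :=
  Polynomial.eval₂RingHom (ev v.1) v.2

theorem polyEval_apply (ev : U → R →+* ℂ) (v : U × ℂ) (A : Polynomial R) :
    polyEval ev v A = ∑ i ∈ Finset.range (A.natDegree + 1), ev v.1 (A.coeff i) * v.2 ^ i := by
  simp [polyEval, Polynomial.eval₂_eq_sum_range]

theorem polyEval_eq_eval_map (ev : U → R →+* ℂ) (v : U × ℂ) (A : Polynomial R) :
    polyEval ev v A = (A.map (ev v.1)).eval v.2 := by
  simp [polyEval, Polynomial.eval_map]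

variable [NormedAddCommGroup U] [NormedSpace ℂ U]

/-- The map `π` has a local section with values in `W` passing through `u`. Strict
differentiability is asked only at `π u`: this is what the implicit function theorem preserves. -/
def HasLocalSectionAt [Fintype σ] (π : U → σ → ℂ) (W : Set U) (u : U) : Prop :=
  ∃ γ : (σ → ℂ) → U, γ (π u) = u ∧ (∃ γ' : (σ → ℂ) →L[ℂ] U, HasStrictFDerivAt γ γ' (π u)) ∧
    ∀ᶠ s in 𝓝 (π u), π (γ s) = s ∧ γ s ∈ W

/-- `R` is a ring of functions on `U`, evaluated by `ev`, and `π : U → ℂ^σ`. For every algebraic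
subset of `U`, given by finitely many equations `p = 0` with `p ∈ R`, there is a hypersurface
`h = 0` of `ℂ^σ` off which `π` has local sections into that subset through all of its points. -/
def HasGenericSections [Fintype σ] (ev : U → R →+* ℂ) (π : U → σ → ℂ) : Prop :=
  ∀ ps : Finset R, ∃ h : MvPolynomial σ ℂ, h ≠ 0 ∧ ∀ u, (∀ p ∈ ps, ev u p = 0) →
    MvPolynomial.eval (π u) h ≠ 0 → HasLocalSectionAt π {v | ∀ p ∈ ps, ev v p = 0} u

theorem contDiff_polyEval {ev : U → R →+* ℂ} (hev : ∀ r, ContDiff ℂ 1 fun u => ev u r)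
    (A : Polynomial R) : ContDiff ℂ 1 fun v => polyEval ev v A := by
  simp only [polyEval_apply]
  exact ContDiff.sum fun i _ => ((hev _).comp contDiff_fst).mul (contDiff_snd.pow i)

variable [Fintype σ] {ev : U → R →+* ℂ} {π : U → σ → ℂ}

theorem HasLocalSectionAt.const_snd {D : Set U} {u : U} {t : ℂ} {W : Set (U × ℂ)}
    (hD : HasLocalSectionAt π D u) (hW : ∀ v ∈ D, (v, t) ∈ W) :
    HasLocalSectionAt (fun v => π v.1) W (u, t) := by
  obtain ⟨γ, h1, ⟨γ', h2⟩, h3⟩ := hD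
  refine ⟨fun s => (γ s, t), by simp [h1], ⟨_, h2.prodMk (hasStrictFDerivAt_const t _)⟩, ?_⟩
  filter_upwards [h3] with s hs using ⟨hs.1, hW _ hs.2⟩

/-- A section of `D` through `u` extends, by the implicit function theorem, to a section through
`(u, t)` along which `A` vanishes, provided `t` is a simple root of `A` over `u`. -/
theorem HasLocalSectionAt.lift_simple_root (hev : ∀ r, ContDiff ℂ 1 fun u => ev u r)
    {D : Set U} {u : U} {t : ℂ} {A : Polynomial R} {W : Set (U × ℂ)}
    (hD : HasLocalSectionAt π D u) (hA : polyEval ev (u, t) A = 0)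
    (hA' : polyEval ev (u, t) A.derivative ≠ 0)
    (hW : ∀ᶠ v in 𝓝 u, v ∈ D → ∀ z, polyEval ev (v, z) A = 0 → (v, z) ∈ W) :
    HasLocalSectionAt (fun v => π v.1) W (u, t) := by
  obtain ⟨γ, h1, ⟨γ', h2⟩, h3⟩ := hD
  have hE : HasStrictFDerivAt (fun v => polyEval ev v A)
      (fderiv ℂ (fun v => polyEval ev v A) (u, t)) (u, t) :=
    (contDiff_polyEval hev A).contDiffAt.hasStrictFDerivAt one_ne_zero
  set L := fderiv ℂ (fun v => polyEval ev v A) (u, t)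
  have hΓ : HasStrictFDerivAt (fun w : (σ → ℂ) × ℂ => (γ w.1, w.2))
      ((γ'.comp (.fst ℂ _ _)).prod (.snd ℂ _ _)) (π u, t) :=
    (HasStrictFDerivAt.comp (π u, t) (f := Prod.fst) h2 hasStrictFDerivAt_fst).prodMk
      hasStrictFDerivAt_snd
  have hG : HasStrictFDerivAt (fun w : (σ → ℂ) × ℂ => polyEval ev (γ w.1, w.2) A)
      (L.comp ((γ'.comp (.fst ℂ _ _)).prod (.snd ℂ _ _))) (π u, t) :=
    HasStrictFDerivAt.comp (π u, t) (f := fun w : (σ → ℂ) × ℂ => (γ w.1, w.2))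
      (g := fun v => polyEval ev v A) (by simpa [h1] using hE) hΓ
  -- the partial derivative of the evaluation of `A` in the fibre direction is that of `A'`
  have hpart : ∀ z : ℂ, L (0, z) = z * polyEval ev (u, t) A.derivative := by
    have e1 : HasFDerivAt (fun z : ℂ => polyEval ev (u, z) A) (L.comp (.inr ℂ U ℂ)) t :=
      HasFDerivAt.comp t (f := fun z : ℂ => (u, z)) hE.hasFDerivAt (hasFDerivAt_prodMk_right u t)
    have e2 : HasDerivAt (fun z : ℂ => polyEval ev (u, z) A)
        (polyEval ev (u, t) A.derivative) t := by
      simp only [polyEval_eq_eval_map, ← Polynomial.derivative_map]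
      exact Polynomial.hasDerivAt _ _
    intro z
    have := congrArg (fun T : ℂ →L[ℂ] ℂ => T z) (e1.unique e2.hasFDerivAt)
    simpa using this
  have hinv : ((L.comp ((γ'.comp (.fst ℂ (σ → ℂ) ℂ)).prod (.snd ℂ _ _))) ∘L
      .inr ℂ (σ → ℂ) ℂ).IsInvertible := by
    refine ⟨ContinuousLinearEquiv.unitsEquivAut ℂ (Units.mk0 _ hA'), ?_⟩
    ext
    simp [hpart]
  have hφ := hG.eventually_apply_implicitFunctionOfProdDomain hinv
  have hφ' := hG.hasStrictFDerivAt_implicitFunctionOfProdDomain hinv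
  have hφ0 := (hG.eventually_apply_eq_iff_implicitFunctionOfProdDomain hinv).self_of_nhds.mp rfl
  set φ := hG.implicitFunctionOfProdDomain hinv
  simp only at hφ hφ' hφ0
  refine ⟨fun s => (γ s, φ s), by simp [h1, hφ0], ⟨_, h2.prodMk hφ'⟩, ?_⟩
  have hc : ∀ᶠ s in 𝓝 (π u), γ s ∈ D → ∀ z, polyEval ev (γ s, z) A = 0 → (γ s, z) ∈ W :=
    h2.hasFDerivAt.continuousAt.eventually (by rwa [h1])
  filter_upwards [h3, hc, hφ] with s hs hs' hs''
  refine ⟨hs.1, hs' hs.2 _ ?_⟩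
  rw [hs'', h1, hA]

theorem map_eraseLead_of_leadingCoeff_eq_zero {S : Type*} [CommRing S] (f : R →+* S)
    (A : Polynomial R) (h : f A.leadingCoeff = 0) : A.eraseLead.map f = A.map f := by
  conv_rhs => rw [← A.eraseLead_add_C_mul_X_pow]
  rw [Polynomial.map_add, Polynomial.map_mul, Polynomial.map_C, h]
  simp

/-- Generic sections through the points of `{ps = 0}` whose fibre coordinate is a root of a given `A`
that does not vanish identically over the base point. The proof is the descent on the degree
of `A`. -/
theorem HasGenericSections.exists_of_root (hev : ∀ r, ContDiff ℂ 1 fun u => ev u r)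
    (hR : HasGenericSections ev π) (ps : Finset (Polynomial R)) (A : Polynomial R) :
    ∃ h : MvPolynomial σ ℂ, h ≠ 0 ∧ ∀ v : U × ℂ, (∀ p ∈ ps, polyEval ev v p = 0) →
      A.map (ev v.1) ≠ 0 → polyEval ev v A = 0 → MvPolynomial.eval (π v.1) h ≠ 0 →
      HasLocalSectionAt (fun v => π v.1) {v | ∀ p ∈ ps, polyEval ev v p = 0} v := by
  classical
  induction hn : A.natDegree using Nat.strong_induction_on generalizing A with
  | _ n ih =>
    rcases Nat.eq_zero_or_pos A.natDegree with h0 | hpos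
    · refine ⟨1, one_ne_zero, fun v _ hne hz _ => absurd ?_ hne⟩
      rw [Polynomial.eq_C_of_natDegree_eq_zero h0] at hz ⊢
      simpa [polyEval] using hz
    obtain ⟨h₁, h₁0, H₁⟩ := ih _ (hn ▸ (Nat.lt_of_le_of_lt A.eraseLead_natDegree_le (by omega)))
      A.eraseLead rfl
    obtain ⟨h₂, h₂0, H₂⟩ := ih _ (hn ▸ Polynomial.natDegree_derivative_lt hpos.ne')
      (Polynomial.derivative A) rfl
    choose k Q r hdiv hr using Polynomial.exists_pseudo_remainder hpos
    choose h₃ h₃0 H₃ using fun p => ih _ (hn ▸ hr p) (r p) rfl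
    obtain ⟨h₄, h₄0, H₄⟩ := hR (ps.biUnion fun p => (r p).coeffs)
    refine ⟨h₁ * h₂ * (∏ p ∈ ps, h₃ p) * h₄, by simp [*, Finset.prod_eq_zero_iff], ?_⟩
    rintro ⟨u, t⟩ hps hne hz hh
    simp only [map_mul, map_prod, mul_ne_zero_iff, Finset.prod_ne_zero_iff] at hh
    obtain ⟨⟨⟨hh₁, hh₂⟩, hh₃⟩, hh₄⟩ := hh
    by_cases hlc : ev u A.leadingCoeff = 0
    · have e := map_eraseLead_of_leadingCoeff_eq_zero (ev u) A hlc
      refine H₁ _ hps (by simpa [e] using hne) ?_ hh₁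
      rw [polyEval_eq_eval_map] at hz ⊢
      simpa [e] using hz
    by_cases hder : polyEval ev (u, t) (Polynomial.derivative A) = 0
    · refine H₂ _ hps (fun h => ?_) hder hh₂
      -- in characteristic zero the leading coefficient of `A'` at `u` is nonzero
      have hcoeff := congrArg (fun q => q.coeff (A.natDegree - 1)) h
      simp only [Polynomial.coeff_map, Polynomial.coeff_derivative,
        Nat.sub_add_cancel hpos, map_mul, Polynomial.coeff_zero] at hcoeff
      rcases mul_eq_zero.1 hcoeff with h | h
      · exact hlc h
      · rw [← Nat.cast_succ, map_natCast, Nat.cast_eq_zero] at h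
        omega
    by_cases hrem : ∃ p ∈ ps, (r p).map (ev u) ≠ 0
    · obtain ⟨p, hp, hrp⟩ := hrem
      refine H₃ p _ hps hrp ?_ (hh₃ p hp)
      have := congrArg (polyEval ev (u, t)) (hdiv p)
      simpa [hps p hp, hz] using this.symm
    push Not at hrem
    have hD := H₄ u (fun c hc => by
      obtain ⟨p, hp, hc⟩ := Finset.mem_biUnion.1 hc
      obtain ⟨i, -, rfl⟩ := Polynomial.mem_coeffs_iff.1 hc
      simpa using congrArg (fun q => q.coeff i) (hrem p hp)) hh₄
    -- near `u` in the locus where all remainders vanish, `A = 0` implies `p = 0` for all `p ∈ ps`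
    refine hD.lift_simple_root hev hz hder ?_
    filter_upwards [(hev A.leadingCoeff).continuous.continuousAt.eventually_ne hlc]
      with w hw hwD z hAz p hp
    have hrw : (r p).map (ev w) = 0 := by
      ext i
      rw [Polynomial.coeff_map, Polynomial.coeff_zero]
      by_cases hi : (r p).coeff i = 0
      · simp [hi]
      · exact hwD _ (Finset.mem_biUnion.2 ⟨p, hp, Polynomial.coeff_mem_coeffs hi⟩)
    have := congrArg (polyEval ev (w, z)) (hdiv p)
    rw [map_add, map_mul, map_mul, map_pow, hAz, polyEval_eq_eval_map ev _ (r p), hrw] at this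
    simpa [polyEval, hw] using this

/-- The property is inherited on adding one fibre coordinate. -/
theorem HasGenericSections.polynomial (hev : ∀ r, ContDiff ℂ 1 fun u => ev u r)
    (hR : HasGenericSections ev π) :
    HasGenericSections (polyEval ev) (fun v : U × ℂ => π v.1) := by
  classical
  intro ps
  choose h₁ h₁0 H₁ using fun A => hR.exists_of_root hev ps A
  obtain ⟨h₂, h₂0, H₂⟩ := hR (ps.biUnion fun p => p.coeffs)
  refine ⟨(∏ p ∈ ps, h₁ p) * h₂, by simp [*, Finset.prod_eq_zero_iff], ?_⟩
  rintro ⟨u, t⟩ hps hh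
  simp only [map_mul, map_prod, mul_ne_zero_iff, Finset.prod_ne_zero_iff] at hh
  by_cases hne : ∃ p ∈ ps, p.map (ev u) ≠ 0
  · obtain ⟨p, hp, hpu⟩ := hne
    exact H₁ p _ hps hpu (hps p hp) (hh.1 p hp)
  push Not at hne
  refine HasLocalSectionAt.const_snd (H₂ u (fun c hc => ?_) hh.2) fun w hw p hp => ?_
  · obtain ⟨p, hp, hc⟩ := Finset.mem_biUnion.1 hc
    obtain ⟨i, -, rfl⟩ := Polynomial.mem_coeffs_iff.1 hc
    simpa using congrArg (fun q => q.coeff i) (hne p hp)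
  · rw [polyEval_apply]
    refine Finset.sum_eq_zero fun i _ => ?_
    by_cases hi : p.coeff i = 0
    · simp [hi]
    · simp [show ev w (p.coeff i) = 0 from
        hw _ (Finset.mem_biUnion.2 ⟨p, hp, Polynomial.coeff_mem_coeffs hi⟩)]

theorem hasGenericSections_eval :
    HasGenericSections (fun c : σ → ℂ => MvPolynomial.eval c) id := by
  intro ps
  by_cases h : ∃ p ∈ ps, p ≠ 0
  · obtain ⟨p, hp, hp0⟩ := h
    exact ⟨p, hp0, fun u hu hne => absurd (hu p hp) hne⟩
  · push Not at h
    refine ⟨1, one_ne_zero, fun u _ _ => ⟨id, rfl, ⟨.id ℂ _, hasStrictFDerivAt_id _⟩, ?_⟩⟩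
    refine Filter.Eventually.of_forall fun s => ⟨rfl, fun p hp => ?_⟩
    simp [h p hp]

/-- `HasGenericSections` passes along a change of coordinates `e` on the total space. -/
theorem HasGenericSections.transfer {U' R' : Type*} [NormedAddCommGroup U'] [NormedSpace ℂ U']
    [CommRing R'] {ev' : U' → R' →+* ℂ} {π' : U' → σ → ℂ} (hR : HasGenericSections ev π)
    (φ : R' →+* R) (e : U → U') (he : ContDiff ℂ 1 e) (hsurj : Function.Surjective e)
    (hev : ∀ u r, ev' (e u) r = ev u (φ r)) (hπ : ∀ u, π' (e u) = π u) :
    HasGenericSections ev' π' := by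
  classical
  intro ps
  obtain ⟨h, h0, H⟩ := hR (ps.image φ)
  refine ⟨h, h0, fun u' hu hne => ?_⟩
  obtain ⟨u, rfl⟩ := hsurj u'
  obtain ⟨γ, h1, ⟨γ', h2⟩, h3⟩ := H u (by simpa [hev] using hu) (by simpa [hπ] using hne)
  refine ⟨e ∘ γ, by simp [hπ, h1], ⟨(fderiv ℂ e (γ (π u))).comp γ', ?_⟩, ?_⟩
  · rw [hπ]
    exact HasStrictFDerivAt.comp (π u) (he.contDiffAt.hasStrictFDerivAt one_ne_zero) h2
  · rw [hπ]
    filter_upwards [h3] with s hs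
    exact ⟨by simpa [hπ] using hs.1, by simpa [hev] using hs.2⟩

theorem MvPolynomial.contDiff_eval (p : MvPolynomial σ ℂ) :
    ContDiff ℂ 1 fun c : σ → ℂ => MvPolynomial.eval c p := by
  induction p using MvPolynomial.induction_on with
  | C a => simpa using contDiff_const
  | add p q hp hq => simpa using hp.add hq
  | mul_X p i hp => simpa using hp.mul (contDiff_apply ℂ ℂ i)

/-- Evaluation of polynomials in `k` fibre coordinates with polynomial coefficients in the base
coordinates, at a point of `ℂ^k × ℂ^σ`. The two groups of variables are kept apart so that fibre
coordinates can be added one at a time. -/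
noncomputable def towerEval (σ : Type*) (k : ℕ) (v : (Fin k → ℂ) × (σ → ℂ)) :
    MvPolynomial (Fin k) (MvPolynomial σ ℂ) →+* ℂ :=
  MvPolynomial.eval₂Hom (MvPolynomial.eval v.2) v.1

theorem contDiff_towerEval (k : ℕ) (p : MvPolynomial (Fin k) (MvPolynomial σ ℂ)) :
    ContDiff ℂ 1 fun v => towerEval σ k v p := by
  induction p using MvPolynomial.induction_on with
  | C a =>
    simp only [towerEval, MvPolynomial.coe_eval₂Hom, MvPolynomial.eval₂_C]
    exact (MvPolynomial.contDiff_eval a).comp contDiff_snd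
  | add p q hp hq => simpa using hp.add hq
  | mul_X p i hp =>
    simp only [towerEval, map_mul, MvPolynomial.coe_eval₂Hom, MvPolynomial.eval₂_X]
    exact ContDiff.mul hp ((contDiff_apply ℂ ℂ i).comp contDiff_fst)

theorem hasGenericSections_towerEval (k : ℕ) :
    HasGenericSections (towerEval σ k) Prod.snd := by
  induction k with
  | zero =>
    refine hasGenericSections_eval.transfer (MvPolynomial.eval₂Hom (RingHom.id _) fun i => i.elim0)
      (fun c => (0, c)) (contDiff_const.prodMk contDiff_id)
      (fun v => ⟨v.2, Prod.ext (Subsingleton.elim _ _) rfl⟩) (fun c r => ?_) (fun c => rfl)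
    obtain ⟨p, rfl⟩ := MvPolynomial.C_surjective (Fin 0) r
    simp [towerEval]
  | succ k ih =>
    refine (ih.polynomial (contDiff_towerEval k)).transfer
      (MvPolynomial.finSuccEquiv (MvPolynomial σ ℂ) k : _ →+* _)
      (fun v => (Fin.cons v.2 v.1.1, v.1.2)) ?_ ?_ (fun v r => ?_) (fun v => rfl)
    · refine ContDiff.prodMk (contDiff_pi.2 fun i => ?_) (contDiff_snd.comp contDiff_fst)
      refine Fin.cases ?_ (fun j => ?_) i
      · simpa using contDiff_snd
      · simp only [Fin.cons_succ]
        exact (contDiff_apply ℂ ℂ j).comp (contDiff_fst.comp contDiff_fst)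
    · exact fun v => ⟨((Fin.tail v.1, v.2), v.1 0), by simp⟩
    · rw [← RingHom.comp_apply]
      congr 1
      refine MvPolynomial.ringHom_ext (fun c => ?_) fun i => ?_
      · simp [towerEval, polyEval, MvPolynomial.finSuccEquiv_apply]
      · refine Fin.cases ?_ (fun j => ?_) i <;>
          simp [towerEval, polyEval, MvPolynomial.finSuccEquiv_apply]

end Sections

/-! ### The incidence set of a sparse system -/

section Application

theorem pow_toNat_mul_pow_toNat {K : Type*} [Field K] {a b : K} (h : a * b = 1) (k : ℤ) :
    a ^ k.toNat * b ^ (-k).toNat = a ^ k := by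
  obtain rfl := eq_inv_of_mul_eq_one_right h
  obtain ⟨l, rfl | rfl⟩ := k.eq_nat_or_neg <;> simp

variable {m n : ℕ} (B : Fin n → Finset (Fin m → ℤ))

/-- The `i`-th universal Laurent polynomial with support `B i`, with indeterminate coefficients,
written as a polynomial in the `x j` (the first `m` fibre variables) and their inverses (the last
`m`). -/
noncomputable def universalSparse (i : Fin n) :
    MvPolynomial (Fin (m + m)) (MvPolynomial (Σ i, B i) ℂ) :=
  ∑ b : B i, MvPolynomial.C (MvPolynomial.X ⟨i, b⟩) *
    ∏ j, MvPolynomial.X (Fin.castAdd m j) ^ ((b : Fin m → ℤ) j).toNat *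
      MvPolynomial.X (Fin.natAdd m j) ^ (-(b : Fin m → ℤ) j).toNat

variable {B}

theorem towerEval_universalSparse {c : (Σ i, B i) → ℂ} {z : Fin (m + m) → ℂ}
    (hz : ∀ j, z (Fin.castAdd m j) * z (Fin.natAdd m j) = 1) (i : Fin n) :
    towerEval _ (m + m) (z, c) (universalSparse B i) =
      sparseMap B c (fun j => z (Fin.castAdd m j)) i := by
  simp [-Fin.natAdd_eq_addNat, towerEval, universalSparse, sparseMap,
    pow_toNat_mul_pow_toNat (hz _)]

theorem towerEval_aeval_universalSparse {c : (Σ i, B i) → ℂ} {z : Fin (m + m) → ℂ}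
    (hz : ∀ j, z (Fin.castAdd m j) * z (Fin.natAdd m j) = 1) (p : MvPolynomial (Fin n) ℂ) :
    towerEval _ (m + m) (z, c) (MvPolynomial.aeval (universalSparse B) p) =
      MvPolynomial.eval (sparseMap B c (fun j => z (Fin.castAdd m j))) p := by
  rw [← RingHom.coe_coe (MvPolynomial.aeval (universalSparse B)), ← RingHom.comp_apply]
  congr 1
  refine MvPolynomial.ringHom_ext (fun a => ?_) fun i => ?_
  · simp [towerEval, MvPolynomial.algebraMap_eq, IsScalarTower.algebraMap_apply ℂ
      (MvPolynomial (Σ i, B i) ℂ) (MvPolynomial (Fin (m + m)) (MvPolynomial (Σ i, B i) ℂ))]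
  · simp [towerEval_universalSparse hz]

theorem IsAlgebraicSet.exists_finset {σ : Type*} [Finite σ] {X : Set (σ → ℂ)}
    (hX : IsAlgebraicSet X) : ∃ ps : Finset (MvPolynomial σ ℂ),
      X = {x | ∀ p ∈ ps, MvPolynomial.eval x p = 0} := by
  obtain ⟨I, rfl⟩ := hX
  obtain ⟨ps, rfl⟩ := (isNoetherian_def.1 inferInstance I : I.FG)
  refine ⟨ps, Set.ext fun x => ?_⟩
  rw [MvPolynomial.zeroLocus_span]
  simp

theorem IsAlgebraicSet.isClosed {σ : Type*} [Fintype σ] {X : Set (σ → ℂ)}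
    (hX : IsAlgebraicSet X) : IsClosed X := by
  obtain ⟨ps, rfl⟩ := hX.exists_finset
  simp only [Set.ofPred_forall]
  exact isClosed_biInter fun p _ =>
    isClosed_eq (MvPolynomial.contDiff_eval p).continuous continuous_const

/-- For generic `c`, every `x` in the torus with `f_c(x) ∈ X` extends to a differentiable family of
such points for the coefficients near `c`. -/
theorem exists_generic_section_sparseMap {X : Set (Fin n → ℂ)} (hX : IsAlgebraicSet X) :
    ∃ h : MvPolynomial (Σ i, B i) ℂ, h ≠ 0 ∧ ∀ c, MvPolynomial.eval c h ≠ 0 →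
      ∀ x ∈ complexTorus m, sparseMap B c x ∈ X →
        ∃ ξ : ((Σ i, B i) → ℂ) → Fin m → ℂ, ξ c = x ∧ DifferentiableAt ℂ ξ c ∧
          ∀ᶠ s in 𝓝 c, sparseMap B s (ξ s) ∈ X := by
  classical
  obtain ⟨ps, rfl⟩ := hX.exists_finset
  -- the equation `x j * y j = 1`
  let unitEq (j : Fin m) : MvPolynomial (Fin (m + m)) (MvPolynomial (Σ i, B i) ℂ) :=
    MvPolynomial.X (Fin.castAdd m j) * MvPolynomial.X (Fin.natAdd m j) - 1
  have hunit : ∀ (z : Fin (m + m) → ℂ) (c : (Σ i, B i) → ℂ) (j : Fin m),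
      towerEval _ (m + m) (z, c) (unitEq j) = 0 ↔
        z (Fin.castAdd m j) * z (Fin.natAdd m j) = 1 := fun z c j => by
    simp [towerEval, unitEq, sub_eq_zero]
  obtain ⟨h, h0, H⟩ := hasGenericSections_towerEval (σ := Σ i, B i) (m + m)
    (Finset.univ.image unitEq ∪ ps.image (MvPolynomial.aeval (universalSparse B)))
  refine ⟨h, h0, fun c hc x hx hxX => ?_⟩
  have hz : ∀ j, Fin.append x x⁻¹ (Fin.castAdd m j) * Fin.append x x⁻¹ (Fin.natAdd m j) = 1 :=
    fun j => by simp [-Fin.natAdd_eq_addNat, hx j]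
  obtain ⟨γ, h1, ⟨γ', h2⟩, h3⟩ := H (Fin.append x x⁻¹, c) (fun p hp => by
    rcases Finset.mem_union.1 hp with hp | hp
    · obtain ⟨j, -, rfl⟩ := Finset.mem_image.1 hp
      exact (hunit _ _ _).2 (hz j)
    · obtain ⟨q, hq, rfl⟩ := Finset.mem_image.1 hp
      rw [towerEval_aeval_universalSparse hz]
      simpa using hxX q hq) hc
  refine ⟨fun s j => (γ s).1 (Fin.castAdd m j), ?_, ?_, ?_⟩
  · simp only at h1
    simp [h1]
  · have h4 : DifferentiableAt ℂ γ c := h2.hasFDerivAt.differentiableAt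
    exact differentiableAt_pi.2 fun j => differentiableAt_pi.1 h4.fst _
  · filter_upwards [h3] with s ⟨hs, hs'⟩ p hp
    have hz' : ∀ j, (γ s).1 (Fin.castAdd m j) * (γ s).1 (Fin.natAdd m j) = 1 := fun j =>
      (hunit _ (γ s).2 _).1 (hs' _ (Finset.mem_union_left _ (Finset.mem_image_of_mem _ (by simp))))
    have hs₂ : (γ s).2 = s := hs
    rw [← towerEval_aeval_universalSparse hz', show ((γ s).1, s) = γ s from Prod.ext rfl hs₂.symm]
    exact hs' _ (Finset.mem_union_right _ (Finset.mem_image_of_mem _ hp))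

/-! ### Transversality -/

theorem analyticAt_sparseMap (c : (Σ i, B i) → ℂ) {x : Fin m → ℂ} (hx : x ∈ complexTorus m) :
    AnalyticAt ℂ (fun w : ((Σ i, B i) → ℂ) × (Fin m → ℂ) => sparseMap B w.1 w.2) (c, x) := by
  refine AnalyticAt.pi fun i => ?_
  refine Finset.analyticAt_fun_sum _ fun b _ => AnalyticAt.mul ?_ ?_
  · exact ((ContinuousLinearMap.proj (R := ℂ) (φ := fun _ : Σ i, B i => ℂ) ⟨i, b⟩).comp
      (.fst ℂ _ (Fin m → ℂ))).analyticAt _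
  · refine Finset.analyticAt_fun_prod _ fun j _ => AnalyticAt.zpow ?_ (hx j)
    exact ((ContinuousLinearMap.proj (R := ℂ) (φ := fun _ : Fin m => ℂ) j).comp
      (.snd ℂ ((Σ i, B i) → ℂ) _)).analyticAt _

/-- Evaluation at a point of the torus is surjective on tuples of Laurent polynomials. -/
theorem exists_sparseMap_eq (hB : ∀ i, (B i).Nonempty) {x : Fin m → ℂ}
    (hx : x ∈ complexTorus m) (v : Fin n → ℂ) : ∃ δ, sparseMap B δ x = v := by
  classical
  choose b hb using hB
  -- take each polynomial to be a multiple of a single monomial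
  refine ⟨fun k => if (k.2 : Fin m → ℤ) = b k.1 then v k.1 / ∏ j, x j ^ b k.1 j else 0,
    funext fun i => ?_⟩
  have hne : ∏ j, x j ^ b i j ≠ 0 := Finset.prod_ne_zero_iff.2 fun j _ => zpow_ne_zero _ (hx j)
  rw [sparseMap, Finset.sum_eq_single ⟨b i, hb i⟩]
  · simp [hne]
  · intro k _ hk
    have : (k : Fin m → ℤ) ≠ b i := fun h => hk (Subtype.ext h)
    simp [this]
  · simp

/-- The map `(c, x) ↦ f_c(x)` is linear in `c`. -/
theorem fderiv_sparseMap_coeff (c δ : (Σ i, B i) → ℂ) {x : Fin m → ℂ}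
    (hx : x ∈ complexTorus m) :
    fderiv ℂ (fun w : ((Σ i, B i) → ℂ) × (Fin m → ℂ) => sparseMap B w.1 w.2) (c, x) (δ, 0) =
      sparseMap B δ x := by
  let T : ((Σ i, B i) → ℂ) →ₗ[ℂ] (Fin n → ℂ) :=
    { toFun := fun s => sparseMap B s x
      map_add' := fun s t => by ext i; simp [sparseMap, add_mul, Finset.sum_add_distrib]
      map_smul' := fun a s => by ext i; simp [sparseMap, Finset.mul_sum, mul_assoc] }
  have e1 := HasFDerivAt.comp c (f := fun s => (s, x))
    (analyticAt_sparseMap c hx).differentiableAt.hasFDerivAt (hasFDerivAt_prodMk_left c x)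
  have e2 : HasFDerivAt (fun s => sparseMap B s x) T.toContinuousLinearMap c :=
    T.toContinuousLinearMap.hasFDerivAt
  exact congrArg (fun L : _ →L[ℂ] _ => L δ) (e1.unique e2)

/-- A differentiable family of points `ξ s` with `f_s(ξ s) ∈ V` forces `f_c` to be transversal to `V`
at `ξ c`. -/
theorem sup_ker_eq_top_of_section (hB : ∀ i, (B i).Nonempty) {k : ℕ} {V : Set (Fin n → ℂ)}
    {g : (Fin n → ℂ) → Fin k → ℂ} {c : (Σ i, B i) → ℂ} {x : Fin m → ℂ} (hx : x ∈ complexTorus m)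
    (hg : IsRegularSystemAt g V (sparseMap B c x)) {ξ : ((Σ i, B i) → ℂ) → Fin m → ℂ}
    (hξ : ξ c = x) (hξd : DifferentiableAt ℂ ξ c) (hV : ∀ᶠ s in 𝓝 c, sparseMap B s (ξ s) ∈ V) :
    LinearMap.range (fderiv ℂ (sparseMap B c) x).toLinearMap ⊔
      LinearMap.ker (fderiv ℂ g (sparseMap B c x)).toLinearMap = ⊤ := by
  subst hξ
  have hF := (analyticAt_sparseMap c hx).differentiableAt.hasFDerivAt
  have hcoeff := fun δ => fderiv_sparseMap_coeff c δ hx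
  set L := fderiv ℂ (fun w : ((Σ i, B i) → ℂ) × (Fin m → ℂ) => sparseMap B w.1 w.2) (c, ξ c)
  have hx' : fderiv ℂ (sparseMap B c) (ξ c) = L.comp (.inr ℂ _ _) :=
    (hF.comp (ξ c) (hasFDerivAt_prodMk_right c (ξ c))).fderiv
  have hs : HasFDerivAt (fun s => sparseMap B s (ξ s))
      (L.comp ((ContinuousLinearMap.id ℂ _).prod (fderiv ℂ ξ c))) c :=
    HasFDerivAt.comp c (f := fun s => (s, ξ s)) hF ((hasFDerivAt_id c).prodMk hξd.hasFDerivAt)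
  have hgs := (hg.analyticAt.differentiableAt.hasFDerivAt).comp c hs
  have hzero : (g ∘ fun s => sparseMap B s (ξ s)) =ᶠ[𝓝 c] fun _ => 0 := by
    filter_upwards [hV, hs.continuousAt.eventually hg.mem_iff] with s h1 h2 using h2.1 h1
  have hker := hgs.unique ((hasFDerivAt_const (0 : Fin k → ℂ) c).congr_of_eventuallyEq hzero)
  rw [eq_top_iff]
  rintro v -
  obtain ⟨δ, hδ⟩ := exists_sparseMap_eq hB hx v
  have hsplit : v = L (0, -fderiv ℂ ξ c δ) + L (δ, fderiv ℂ ξ c δ) := by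
    rw [← map_add, ← hδ, ← hcoeff]
    simp
  rw [hsplit]
  refine Submodule.add_mem_sup ⟨-fderiv ℂ ξ c δ, by simp [hx']⟩ ?_
  simpa using congrArg (fun T : _ →L[ℂ] _ => T δ) hker

theorem isOpen_complexTorus (m : ℕ) : IsOpen (complexTorus m) := by
  simp only [complexTorus, Set.ofPred_forall]
  exact isOpen_iInter_of_finite fun j => isOpen_ne_fun (continuous_apply j) continuous_const

/-- Equations of `V` pull back to equations of the preimage at points of transversality. -/
theorem IsRegularSystemAt.comp_of_sup_ker_eq_top {k : ℕ} {V : Set (Fin n → ℂ)}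
    {g : (Fin n → ℂ) → Fin k → ℂ} {f : (Fin m → ℂ) → Fin n → ℂ} {x : Fin m → ℂ}
    {T : Set (Fin m → ℂ)} (hT : T ∈ 𝓝 x) (hg : IsRegularSystemAt g V (f x))
    (hf : AnalyticAt ℂ f x)
    (h : LinearMap.range (fderiv ℂ f x).toLinearMap ⊔
      LinearMap.ker (fderiv ℂ g (f x)).toLinearMap = ⊤) :
    IsRegularSystemAt (g ∘ f) {y | y ∈ T ∧ f y ∈ V} x where
  analyticAt := hg.analyticAt.comp hf
  surjective := fun w => by
    obtain ⟨v, rfl⟩ := hg.surjective w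
    obtain ⟨_, ⟨a, rfl⟩, b, hb, rfl⟩ := Submodule.mem_sup.1 (h ▸ Submodule.mem_top : v ∈ _)
    refine ⟨a, ?_⟩
    rw [fderiv_comp _ hg.analyticAt.differentiableAt hf.differentiableAt]
    simpa using hb
  mem_iff := by
    filter_upwards [hT, hf.continuousAt.eventually hg.mem_iff] with y hy h1
    simp [hy, h1]

end Application

theorem theorem5p5 (m n : ℕ) (V : Set (Fin n → ℂ))
    (hV : IsDifferenceOfAlgebraicSets V) (hsmooth : IsSmoothSet V)
    (B : Fin n → Finset (Fin m → ℤ)) (hB : ∀ i, (B i).Nonempty) :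
    HoldsGenerically (fun c : (Σ i, B i) → ℂ =>
      (∀ x ∈ complexTorus m, IsTransversalAt (sparseMap B c) V x) ∧
        IsSmoothSet {x | x ∈ complexTorus m ∧ sparseMap B c x ∈ V}) := by
  obtain ⟨X, Y, hX, hY, rfl⟩ := hV
  obtain ⟨h, h0, H⟩ := exists_generic_section_sparseMap (B := B) hX
  refine ⟨_, ⟨Ideal.span {h}, rfl⟩, fun huniv => h0 ?_, fun c hc => ?_⟩
  · refine MvPolynomial.funext fun c => ?_
    have : c ∈ MvPolynomial.zeroLocus ℂ (Ideal.span {h}) := huniv ▸ Set.mem_univ c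
    simpa [MvPolynomial.zeroLocus_span] using this
  have hc' : MvPolynomial.eval c h ≠ 0 := by simpa [MvPolynomial.zeroLocus_span] using hc
  have han : ∀ x ∈ complexTorus m, AnalyticAt ℂ (sparseMap B c) x := fun x hx =>
    (analyticAt_sparseMap c hx).comp₂ analyticAt_const analyticAt_id
  have htrans : ∀ x ∈ complexTorus m, IsTransversalAt (sparseMap B c) (X \ Y) x := by
    intro x hx hxV
    obtain ⟨k, g, hg⟩ := hsmooth _ hxV
    obtain ⟨ξ, rfl, hξd, hξX⟩ := H c hc' x hx hxV.1
    refine ⟨k, g, hg, sup_ker_eq_top_of_section hB hx hg rfl hξd ?_⟩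
    have hcont : ContinuousAt (fun s => sparseMap B s (ξ s)) c :=
      ContinuousAt.comp (f := fun s => (s, ξ s))
        (g := fun w : ((Σ i, B i) → ℂ) × (Fin m → ℂ) => sparseMap B w.1 w.2)
        (analyticAt_sparseMap c hx).continuousAt
        (continuousAt_id.prodMk hξd.continuousAt)
    filter_upwards [hξX, hcont.eventually (hY.isClosed.isOpen_compl.mem_nhds hxV.2)]
      with s h1 h2 using ⟨h1, h2⟩
  refine ⟨htrans, fun x hx => ?_⟩
  obtain ⟨k, g, hg, hsup⟩ := htrans x hx.1 hx.2
  exact ⟨k, g ∘ sparseMap B c, hg.comp_of_sup_ker_eq_top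
    ((isOpen_complexTorus m).mem_nhds hx.1) (han x hx.1) hsup⟩
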